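/- **Setting.** Let $M=(\mathcal S,\mathcal A,P,R,\gamma,s_0)$ be a Markov decision process with finite $\mathcal S,\mathcal A$, transition probabilities $P(\cdot\mid s,a)$, rewards $R:\mathcal S\times\mathcal A\to[0,R_{\max}]$, discount $\gamma\in[0,1)$ and deterministic initial state $s_0$; put $V_{\max}=R_{\max}/(1-\gamma)$. For a stochastic policy $\pi$ and $f:\mathcal S\times\mathcal A\to\mathbb R$ let $f(s,\pi)=\sum_a\pi(a|s)f(s,a)$, $(P^\pi f)(s,a)=\sum_{s'}P(s'|s,a)f(s',\pi)$, $\mathcal T^\pi f=R+\gamma P^\pi f$, $J(\pi)=\mathbb E_\pi[\sum_{t\ge0}\gamma^tR(s_t,a_t)]$ and $d_\pi(s,a)=(1-\gamma)\,\mathbb E_\pi[\sum_{t\ge0}\gamma^t\mathbf 1\{s_t=s,a_t=a\}]$, and write $\|f\|_{2,\nu}^2=\sum_{s,a}\nu(s,a)f(s,a)^2$. Let $\mu$ be a probability distribution on $\mathcal S\times\mathcal A$ and let the data set $\mathcal D$ consist of $n\ge1$ i.i.d. tuples $(s,a,r,s')$ with $(s,a)\sim\mu$, $r=R(s,a)$,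 $s'\sim P(\cdot|s,a)$. Let $F$ be a finite set of functions $\mathcal S\times\mathcal A\to[0,V_{\max}]$, $\Pi$ a finite set of policies, $\delta\in(0,1)$, and let $\varepsilon_F,\varepsilon_{F,F}\ge0$ be such that for every $\pi\in\Pi$ $$\inf_{f\in F}\ \sup_{\nu\in\{d_{\pi'}:\pi'\in\Pi\}\cup\{\mu\}}\|f-\mathcal T^\pi f\|_{2,\nu}^2\le\varepsilon_F,\qquad \sup_{f\in F}\inf_{f'\in F}\|f'-\mathcal T^\pi f\|_{2,\mu}^2\le\varepsilon_{F,F}.$$ Let $\mathcal L(f',f,\pi)=\frac1n\sum_{(s,a,r,s')\in\mathcal D}(f'(s,a)-r-\gamma f(s',\pi))^2$, $\mathcal E(f,\pi)=\mathcal L(f,f,\pi)-\min_{f'\in F}\mathcal L(f',f,\pi)$, $$\varepsilon_r=\frac{139\,V_{\max}^2\log(|F||\Pi|/\delta)}{n}+39\,\varepsilon_F,\qquad F_\pi=\{f\in F:\mathcal E(f,\pi)\le\varepsilon_r\},\qquad \hat\pi\in\operatorname*{argmax}_{\pi\in\Pi}\min_{f\in F_\pi}f(s_0,\pi),$$ and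 $\Delta f_\pi=f_{\pi,\max}-f_{\pi,\min}$, where $f_{\pi,\max}$ and $f_{\pi,\min}$ are a maximizer and a minimizer of $f\mapsto f(s_0,\pi)$ over $F_\pi$. For a probability distribution $\nu$ on $\mathcal S\times\mathcal A$ let $$\mathscr C(\nu;\mu,F,\pi)=\max_{f\in F}\frac{\|f-\mathcal T^\pi f\|_{2,\nu}^2}{\|f-\mathcal T^\pi f\|_{2,\mu}^2}\in[0,\infty]\qquad(0/0=0,\ x/0=\infty\text{ for }x>0).$$ **Theorem.** There is an absolute constant $c>0$ such that in every such setting, with probability at least $1-\delta$, all the sets $F_\pi$, $\pi\in\Pi$, are non-empty and, for every choice of $\hat\pi$, every $\pi\in\Pi$, every choice of $f_{\pi,\max},f_{\pi,\min}$ and every real $C_2\ge1$, $$J(\pi)-J(\hat\pi)\le c\left(\frac{V_{\max}\sqrt{C_2}}{1-\gamma}\sqrt{\frac{\log(|F||\Pi|/\delta)}{n}}+\frac{\sqrt{C_2(\varepsilon_{F,F}+\varepsilon_F)}}{1-\gamma}\right)+\min_{\nu:\ \mathscr C(\nu;\mu,F,\pi)\le C_2}\frac1{1-\gamma}\sum_{s,a}(d_\pi\setminus\nu)(s,a)\,[\Delta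 f_\pi-\gamma P^\pi\Delta f_\pi](s,a),$$ where $(d_\pi\setminus\nu)(s,a)=\max(d_\pi(s,a)-\nu(s,a),0)$, $\nu$ ranges over probability distributions on $\mathcal S\times\mathcal A$, and the minimum is attained. -/

import Mathlib

open scoped ENNReal
open MeasureTheory ProbabilityTheory

universe u v w

/-- A finite discounted Markov decision process with a deterministic initial state. -/
structure MDP (S A : Type*) where
  /-- transition function -/
  P : S × A → PMF S
  /-- reward function -/
  R : S × A → ℝ
  /-- upper bound on the rewards -/
  Rmax : ℝ
  R_mem : ∀ x, R x ∈ Set.Icc 0 Rmax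
  /-- discount factor -/
  γ : ℝ
  γ_nonneg : 0 ≤ γ
  γ_lt_one : γ < 1
  /-- initial state -/
  s₀ : S

/-- A stochastic policy. -/
abbrev Policy (S A : Type*) := S → PMF A

/-- The point masses of a probability mass function as real numbers. -/
noncomputable def PMF.weight {α : Type*} (p : PMF α) : α → ℝ := fun x => (p x).toReal

/-- `f(s, π)`, the mean of `f(s, a)` over `a ∼ π(· | s)`. -/
noncomputable def Policy.avg {S A : Type*} [Fintype A] (π : Policy S A) (f : S × A → ℝ) (s : S) :
    ℝ :=
  ∑ a, (π s).weight a * f (s, a)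

/-- `‖f‖²_{2,w} = ∑ w(s,a) f(s,a)²`. -/
def sqNorm {X : Type*} [Fintype X] (w f : X → ℝ) : ℝ := ∑ x, w x * f x ^ 2

namespace MDP

section Basic

variable {S A : Type*} (M : MDP S A)

/-- `V_max = R_max / (1 - γ)`. -/
noncomputable def Vmax : ℝ := M.Rmax / (1 - M.γ)

/-- `(P^π f)(s,a)`, the mean of `f(s', π)` over `s' ∼ P(· | s,a)`. -/
noncomputable def transOp [Fintype S] [Fintype A] (π : Policy S A) (f : S × A → ℝ) :
    S × A → ℝ :=
  fun x => ∑ s', (M.P x).weight s' * π.avg f s'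

/-- The Bellman operator `T^π f = R + γ P^π f`. -/
noncomputable def bellman [Fintype S] [Fintype A] (π : Policy S A) (f : S × A → ℝ) :
    S × A → ℝ :=
  fun x => M.R x + M.γ * M.transOp π f x

/-- The law of `(s₀, a₀)`, where `a₀ ∼ π(· | s₀)`. -/
noncomputable def initPMF (π : Policy S A) : PMF (S × A) :=
  (π M.s₀).map fun a => (M.s₀, a)

/-- The law of `(s', a')` given `(s, a)`, where `s' ∼ P(· | s,a)` and `a' ∼ π(· | s')`. -/
noncomputable def stepPMF (π : Policy S A) (x : S × A) : PMF (S × A) :=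
  (M.P x).bind fun s' => (π s').map fun a' => (s', a')

end Basic

section Trajectory

variable {S A : Type*} [Fintype S] [Fintype A]
  [MeasurableSpace S] [MeasurableSingletonClass S]
  [MeasurableSpace A] [MeasurableSingletonClass A] (M : MDP S A)

/-- The step from the history up to time `n` to `(s_{n+1}, a_{n+1})`. -/
noncomputable def stepKernel (π : Policy S A) (n : ℕ) :
    Kernel (Finset.Iic n → S × A) (S × A) :=
  Kernel.ofFunOfCountable fun h => (M.stepPMF π (h ⟨n, Finset.mem_Iic.2 le_rfl⟩)).toMeasure

instance (π : Policy S A) (n : ℕ) : IsMarkovKernel (M.stepKernel π n) :=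
  ⟨fun h => PMF.toMeasure.isProbabilityMeasure
    (M.stepPMF π (h ⟨n, Finset.mem_Iic.2 le_rfl⟩))⟩

/-- The law of the random trajectory `(s₀, a₀), (s₁, a₁), …` induced by the policy `π`. -/
noncomputable def trajLaw (π : Policy S A) : Measure (ℕ → S × A) :=
  Kernel.trajMeasure (X := fun _ => S × A) (M.initPMF π).toMeasure (M.stepKernel π)

/-- The expected discounted return `J(π) = E[∑ₜ γᵗ R(sₜ, aₜ) | π]`. -/
noncomputable def J (π : Policy S A) : ℝ :=
  ∫ τ, ∑' t : ℕ, M.γ ^ t * M.R (τ t) ∂M.trajLaw π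

/-- The discounted occupancy `d_π(s,a) = (1 - γ) E[∑ₜ γᵗ 1[(sₜ, aₜ) = (s,a)] | π]`. -/
noncomputable def occ (π : Policy S A) : S × A → ℝ :=
  fun x => (1 - M.γ) * ∫ τ, ∑' t : ℕ, M.γ ^ t * Set.indicator {x} 1 (τ t) ∂M.trajLaw π

/-- Approximate realizability with error `εF`:
`inf_{f ∈ F} sup_ν ‖f - T^π f‖²_{2,ν} ≤ εF` for all `π` in the policy class, where `ν` ranges over
the occupancies of the policies of the class and the data distribution `μ`. -/
def Realizable (μ : PMF (S × A)) (F : Finset (S × A → ℝ)) (Pol : Finset (Policy S A)) (εF : ℝ) :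
    Prop :=
  ∀ π ∈ Pol, (⨅ f ∈ F, ⨆ ν ∈ M.occ '' (Pol : Set (Policy S A)) ∪ {μ.weight},
    ENNReal.ofReal (sqNorm ν (f - M.bellman π f))) ≤ ENNReal.ofReal εF

end Trajectory

section Learning

variable {S A : Type*} [Fintype S] [Fintype A] (M : MDP S A)

/-- Approximate completeness with error `εFF`:
`sup_{f ∈ F} inf_{f' ∈ F} ‖f' - T^π f‖²_{2,μ} ≤ εFF` for all `π` in the policy class. -/
def Complete (μ : PMF (S × A)) (F : Finset (S × A → ℝ)) (Pol : Finset (Policy S A)) (εFF : ℝ) :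
    Prop :=
  ∀ π ∈ Pol, (⨆ f ∈ F, ⨅ f' ∈ F,
    ENNReal.ofReal (sqNorm μ.weight (f' - M.bellman π f))) ≤ ENNReal.ofReal εFF

/-- The distribution shift coefficient
`C(ν; μ, F, π) = max_{f ∈ F} ‖f - T^π f‖²_{2,ν} / ‖f - T^π f‖²_{2,μ}`, with values in `[0, ∞]`
(`0 / 0 = 0` and `x / 0 = ∞` for `x > 0`). -/
noncomputable def shiftCoeff (ν : S × A → ℝ) (μ : PMF (S × A)) (F : Finset (S × A → ℝ))
    (π : Policy S A) : ℝ≥0∞ :=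
  ⨆ f ∈ F, ENNReal.ofReal (sqNorm ν (f - M.bellman π f)) /
    ENNReal.ofReal (sqNorm μ.weight (f - M.bellman π f))

/-- The law of one data tuple `(s, a, r, s')`: `(s,a) ∼ μ`, `r = R(s,a)`, `s' ∼ P(· | s,a)`. -/
noncomputable def samplePMF (μ : PMF (S × A)) : PMF (S × A × ℝ × S) :=
  μ.bind fun x => (M.P x).map fun s' => (x.1, x.2, M.R x, s')

/-- The empirical loss `L(f', f, π; D) = (1/n) ∑ (f'(s,a) - r - γ f(s', π))²`. -/
noncomputable def loss {n : ℕ} (D : Fin n → S × A × ℝ × S) (π : Policy S A)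
    (f' f : S × A → ℝ) : ℝ :=
  (1 / n : ℝ) * ∑ i, (f' ((D i).1, (D i).2.1) - (D i).2.2.1 - M.γ * π.avg f (D i).2.2.2) ^ 2

/-- The empirical Bellman error `E(f, π; D) = L(f, f, π; D) - min_{f' ∈ F} L(f', f, π; D)`. -/
noncomputable def empError {n : ℕ} (D : Fin n → S × A × ℝ × S) (F : Finset (S × A → ℝ))
    (π : Policy S A) (f : S × A → ℝ) : ℝ :=
  M.loss D π f f - ⨅ f' : F, M.loss D π f' f

/-- The version space `F_{π,ε} = {f ∈ F : E(f, π; D) ≤ ε}`. -/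
def versionSpace {n : ℕ} (D : Fin n → S × A × ℝ × S) (F : Finset (S × A → ℝ)) (ε : ℝ)
    (π : Policy S A) : Set (S × A → ℝ) :=
  {f | f ∈ F ∧ M.empError D F π f ≤ ε}

/-- The pessimistic value `min_{f ∈ F_{π,ε}} f(s₀, π)`. -/
noncomputable def pessValue {n : ℕ} (D : Fin n → S × A × ℝ × S) (F : Finset (S × A → ℝ)) (ε : ℝ)
    (π : Policy S A) : ℝ :=
  ⨅ f : M.versionSpace D F ε π, π.avg f M.s₀

/-- `πhat` is a maximizer of the pessimistic value over the policy class. -/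
def IsPessimisticPolicy {n : ℕ} (D : Fin n → S × A × ℝ × S) (F : Finset (S × A → ℝ))
    (Pol : Finset (Policy S A)) (ε : ℝ) (πhat : Policy S A) : Prop :=
  πhat ∈ Pol ∧ IsMaxOn (M.pessValue D F ε) Pol πhat

/-- `f` attains `max_{g ∈ F_{π,ε}} g(s₀, π)`. -/
def IsUpperFn {n : ℕ} (D : Fin n → S × A × ℝ × S) (F : Finset (S × A → ℝ)) (ε : ℝ)
    (π : Policy S A) (f : S × A → ℝ) : Prop :=
  f ∈ M.versionSpace D F ε π ∧ IsMaxOn (fun g => π.avg g M.s₀) (M.versionSpace D F ε π) f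

/-- `f` attains `min_{g ∈ F_{π,ε}} g(s₀, π)`. -/
def IsLowerFn {n : ℕ} (D : Fin n → S × A × ℝ × S) (F : Finset (S × A → ℝ)) (ε : ℝ)
    (π : Policy S A) (f : S × A → ℝ) : Prop :=
  f ∈ M.versionSpace D F ε π ∧ IsMinOn (fun g => π.avg g M.s₀) (M.versionSpace D F ε π) f

/-- The threshold `ε_r = 139 V_max² log(|F||Π|/δ) / n + 39 εF`. -/
noncomputable def threshold (F : Finset (S × A → ℝ)) (Pol : Finset (Policy S A)) (n : ℕ)
    (δ εF : ℝ) : ℝ :=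
  139 * M.Vmax ^ 2 * Real.log ((F.card : ℝ) * Pol.card / δ) / n + 39 * εF

/-- The on-support rate, without its absolute constant. -/
noncomputable def onSupportRate (F : Finset (S × A → ℝ)) (Pol : Finset (Policy S A)) (n : ℕ)
    (δ εF εFF C₂ : ℝ) : ℝ :=
  M.Vmax * √C₂ / (1 - M.γ) * √(Real.log ((F.card : ℝ) * Pol.card / δ) / n) +
    √(C₂ * (εFF + εF)) / (1 - M.γ)

end Learning

/-- `(1/(1-γ)) ∑ (d_π ∖ ν)(s,a) [Δf(s,a) - γ (P^π Δf)(s,a)]`, where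
`(d_π ∖ ν)(s,a) = max(d_π(s,a) - ν(s,a), 0)`. -/
noncomputable def offSupport {S A : Type*} [Fintype S] [Fintype A]
    [MeasurableSpace S] [MeasurableSingletonClass S]
    [MeasurableSpace A] [MeasurableSingletonClass A] (M : MDP S A)
    (π : Policy S A) (Δf ν : S × A → ℝ) : ℝ :=
  1 / (1 - M.γ) * ∑ x, max (M.occ π x - ν x) 0 * (Δf x - M.γ * M.transOp π Δf x)

end MDP

/-! The discounted occupancy satisfies a flow equation: the mean of `g - γ P^π g` under `d_π` is `(1
- γ) g(s₀, π)`. Hence `f(s₀, π) - J(π)` is the mean Bellman error of `f` under `d_π`, divided by `1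
- γ` (`avg_sub_J`).

On the good event every version space contains a function whose Bellman error under the occupancy is
at most `εF`. So `J(π)` is at most about `fmax(s₀, π)`, and the pessimistic value of `πhat` is at
most about `J(πhat)`. Since `πhat` maximizes the pessimistic value, the regret is essentially the
gap `fmax(s₀, π) - fmin(s₀, π)`. By the flow equation this gap is the mean of `Δf - γ P^π Δf` under
`d_π`. Splitting `d_π = (d_π ∖ ν) + min(d_π, ν)` leaves the off-support term and a part dominated by
`ν`. On the latter, rewards cancel and `Δf - γ P^π Δf` is a difference of two Bellman errors, which
Cauchy–Schwarz and the shift coefficient reduce to errors under `μ`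
(`avg_sub_avg_le_offSupport_add`).

Errors under `μ` are small on the version space because differences of square losses concentrate at
rate `1/n`: their second moment is controlled by the squared errors themselves, so an exponential
moment bound loses only the factors `3/2` and `1/2` (`sum_weight_exp_sq_sub_sq_le`,
`exists_uniform_loss_bound`). -/

namespace PMF

/-! ### Finite sums against probability mass functions. -/

lemma weight_nonneg {α : Type*} (p : PMF α) (x : α) : 0 ≤ p.weight x := ENNReal.toReal_nonneg

lemma sum_weight {α : Type*} [Fintype α] (p : PMF α) : ∑ x, p.weight x = 1 := by
  unfold weight
  rw [← ENNReal.toReal_sum fun x _ => p.apply_ne_top x, ← tsum_fintype (L := .unconditional _),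
    p.tsum_coe, ENNReal.toReal_one]

lemma weight_mem_stdSimplex {α : Type*} [Fintype α] (p : PMF α) : p.weight ∈ stdSimplex ℝ α :=
  ⟨p.weight_nonneg, p.sum_weight⟩

lemma sum_weight_mul_const {α : Type*} [Fintype α] (p : PMF α) (c : ℝ) :
    ∑ x, p.weight x * c = c := by
  rw [← Finset.sum_mul, p.sum_weight, one_mul]

lemma sum_weight_pure_mul {α : Type*} [Fintype α] (x : α) (g : α → ℝ) :
    ∑ y, (PMF.pure x).weight y * g y = g x := by
  classical
  rw [Finset.sum_eq_single x] <;> simp +contextual [weight, PMF.pure_apply]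

lemma sum_weight_bind_mul {α β : Type*} [Fintype α] [Fintype β] (p : PMF α) (q : α → PMF β)
    (g : β → ℝ) :
    ∑ y, (p.bind q).weight y * g y = ∑ x, p.weight x * ∑ y, (q x).weight y * g y := by
  have h : ∀ y, (p.bind q).weight y = ∑ x, p.weight x * (q x).weight y := fun y => by
    simp only [weight, PMF.bind_apply, tsum_fintype]
    rw [ENNReal.toReal_sum fun x _ => ENNReal.mul_ne_top (p.apply_ne_top x) ((q x).apply_ne_top y)]
    simp only [ENNReal.toReal_mul]
  simp only [h, Finset.sum_mul, Finset.mul_sum, mul_assoc]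
  exact Finset.sum_comm

lemma sum_weight_map_mul {α β : Type*} [Fintype α] [Fintype β] (p : PMF α) (φ : α → β)
    (g : β → ℝ) :
    ∑ y, (p.map φ).weight y * g y = ∑ x, p.weight x * g (φ x) := by
  simp only [PMF.map, sum_weight_bind_mul, Function.comp_apply, sum_weight_pure_mul]

lemma integral_eq_sum_weight {α : Type*} [Fintype α] [MeasurableSpace α]
    [MeasurableSingletonClass α] (p : PMF α) (g : α → ℝ) :
    ∫ x, g x ∂p.toMeasure = ∑ x, p.weight x * g x := by
  simp [PMF.integral_eq_sum, weight]

end PMF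

namespace Policy

variable {S A : Type*} [Fintype A] (π : Policy S A)

lemma avg_sub (f g : S × A → ℝ) (s : S) : π.avg (f - g) s = π.avg f s - π.avg g s := by
  simp [avg, mul_sub]

lemma avg_mem_Icc {f : S × A → ℝ} {V : ℝ} (hf : ∀ x, f x ∈ Set.Icc 0 V) (s : S) :
    π.avg f s ∈ Set.Icc 0 V := by
  refine ⟨Finset.sum_nonneg fun a _ => mul_nonneg ((π s).weight_nonneg a) (hf _).1, ?_⟩
  rw [← (π s).sum_weight_mul_const V]
  exact Finset.sum_le_sum fun a _ =>
    mul_le_mul_of_nonneg_left (hf _).2 ((π s).weight_nonneg a)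

end Policy

namespace MDP

section Operators

variable {S A : Type*} [Fintype S] [Fintype A] (M : MDP S A) (π : Policy S A)

lemma sum_initPMF_weight_mul (g : S × A → ℝ) :
    ∑ x, (M.initPMF π).weight x * g x = π.avg g M.s₀ := by
  simp only [initPMF, PMF.sum_weight_map_mul, Policy.avg]

lemma sum_stepPMF_weight_mul (g : S × A → ℝ) (x : S × A) :
    ∑ y, (M.stepPMF π x).weight y * g y = M.transOp π g x := by
  simp only [stepPMF, PMF.sum_weight_bind_mul, PMF.sum_weight_map_mul, transOp, Policy.avg]

lemma transOp_sub (f g : S × A → ℝ) :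
    M.transOp π (f - g) = M.transOp π f - M.transOp π g := by
  ext x
  simp [transOp, Policy.avg_sub, mul_sub]

end Operators

/-! ### Discounted occupancies and the flow equation. -/

section Trajectory

variable {S A : Type*} [Fintype S] [Fintype A]
  [MeasurableSpace S] [MeasurableSingletonClass S]
  [MeasurableSpace A] [MeasurableSingletonClass A] (M : MDP S A) (π : Policy S A)

instance : IsProbabilityMeasure (M.trajLaw π) := by
  unfold trajLaw
  infer_instance

lemma map_trajLaw_zero : (M.trajLaw π).map (fun τ => τ 0) = (M.initPMF π).toMeasure := by
  let e := MeasurableEquiv.piUnique fun _ : Finset.Iic 0 => S × A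
  have h : (fun τ : ℕ → S × A => τ 0) = e ∘ Preorder.frestrictLe 0 := rfl
  rw [h, ← Measure.map_map (by fun_prop) (by fun_prop), trajLaw, Kernel.trajMeasure,
    Measure.map_comp _ _ (by fun_prop), Kernel.traj_map_frestrictLe, Kernel.partialTraj_self,
    Measure.id_comp, Measure.map_map (by fun_prop) (by fun_prop)]
  change Measure.map (e ∘ e.symm) _ = _
  simp

/-- The mean of `g(sₜ, aₜ)` under `π`. -/
noncomputable def meanAt (t : ℕ) (g : S × A → ℝ) : ℝ := ∫ τ, g (τ t) ∂M.trajLaw π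

lemma integrable_comp_eval (t : ℕ) (g : S × A → ℝ) :
    Integrable (fun τ : ℕ → S × A => g (τ t)) (M.trajLaw π) := by
  have : Integrable g ((M.trajLaw π).map fun τ => τ t) := by
    have : IsFiniteMeasure ((M.trajLaw π).map fun τ => τ t) := inferInstance
    exact .of_finite
  exact this.comp_measurable (measurable_pi_apply t)

lemma meanAt_zero (g : S × A → ℝ) : M.meanAt π 0 g = π.avg g M.s₀ := by
  rw [meanAt, ← integral_map (φ := fun τ : ℕ → S × A => τ 0) (f := g)
    (measurable_pi_apply 0).aemeasurable (Measurable.of_discrete).aestronglyMeasurable,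
    map_trajLaw_zero, PMF.integral_eq_sum_weight, sum_initPMF_weight_mul]

/-- The Markov property: the step kernel sees the history only through its last entry, so
integrating out the next pair turns `g` into `P^π g`. -/
lemma meanAt_succ (t : ℕ) (g : S × A → ℝ) :
    M.meanAt π (t + 1) g = M.meanAt π t (M.transOp π g) := by
  have hm : Measurable fun τ : ℕ → S × A =>
      (Preorder.frestrictLe (π := fun _ => S × A) t τ, τ (t + 1)) := by fun_prop
  have hg : Measurable fun p : (Finset.Iic t → S × A) × (S × A) => g p.2 :=
    Measurable.of_discrete.comp measurable_snd
  have h := Kernel.map_frestrictLe_trajMeasure_compProd_eq_map_trajMeasure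
    (X := fun _ => S × A) (μ₀ := (M.initPMF π).toMeasure) (κ := M.stepKernel π) (a := t)
  change (M.trajLaw π).map _ ⊗ₘ _ = (M.trajLaw π).map _ at h
  have h2 : M.meanAt π (t + 1) g = ∫ p, g p.2 ∂((M.trajLaw π).map
      fun τ => (Preorder.frestrictLe (π := fun _ => S × A) t τ, τ (t + 1))) := by
    rw [integral_map hm.aemeasurable hg.aestronglyMeasurable]
    rfl
  have hi : Integrable (fun p : (Finset.Iic t → S × A) × (S × A) => g p.2)
      ((M.trajLaw π).map fun τ =>
        (Preorder.frestrictLe (π := fun _ => S × A) t τ, τ (t + 1))) := by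
    rw [integrable_map_measure hg.aestronglyMeasurable hm.aemeasurable]
    exact M.integrable_comp_eval π (t + 1) g
  rw [h2, ← h, Measure.integral_compProd (by rw [h]; exact hi),
    integral_map (by fun_prop) (Measurable.of_discrete).aestronglyMeasurable]
  refine integral_congr_ae (.of_forall fun τ => ?_)
  change ∫ y, g y ∂(M.stepPMF π (τ t)).toMeasure = _
  rw [PMF.integral_eq_sum_weight, sum_stepPMF_weight_mul]

/-- Sum and integral may be exchanged because `g` is bounded on a finite space and the geometric
series in `γ` converges. -/
lemma hasSum_discounted_meanAt (g : S × A → ℝ) :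
    HasSum (fun t => M.γ ^ t * M.meanAt π t g)
      (∫ τ, ∑' t : ℕ, M.γ ^ t * g (τ t) ∂M.trajLaw π) := by
  have hb : ∀ x, |g x| ≤ ∑ y, |g y| := fun x =>
    Finset.single_le_sum (f := fun y => |g y|) (fun _ _ => abs_nonneg _) (Finset.mem_univ x)
  have h := hasSum_integral_of_summable_integral_norm (μ := M.trajLaw π)
    (F := fun (t : ℕ) (τ : ℕ → S × A) => M.γ ^ t * g (τ t))
    (fun t => (M.integrable_comp_eval π t g).const_mul _) ?_
  · simpa only [integral_const_mul, meanAt] using h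
  · refine .of_nonneg_of_le (fun t => integral_nonneg fun _ => norm_nonneg _) (fun t => ?_)
      ((summable_geometric_of_lt_one M.γ_nonneg M.γ_lt_one).mul_right (∑ y, |g y|))
    have : ∀ τ : ℕ → S × A, ‖M.γ ^ t * g (τ t)‖ ≤ M.γ ^ t * ∑ y, |g y| := fun τ => by
      rw [Real.norm_eq_abs, abs_mul, abs_of_nonneg (pow_nonneg M.γ_nonneg t)]
      exact mul_le_mul_of_nonneg_left (hb _) (pow_nonneg M.γ_nonneg t)
    simpa using integral_mono ((M.integrable_comp_eval π t g).const_mul _).norm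
      (integrable_const _) this

lemma meanAt_eq_sum (t : ℕ) (g : S × A → ℝ) :
    M.meanAt π t g = ∑ x, M.meanAt π t (Set.indicator {x} 1) * g x := by
  simp only [meanAt, ← integral_mul_const]
  rw [← integral_finsetSum _ fun x _ =>
    (M.integrable_comp_eval π t (Set.indicator {x} 1)).mul_const _]
  refine integral_congr_ae (.of_forall fun τ => ?_)
  classical
  simp [Set.indicator_apply]

lemma sum_occ_mul (g : S × A → ℝ) :
    ∑ x, M.occ π x * g x = (1 - M.γ) * ∫ τ, ∑' t : ℕ, M.γ ^ t * g (τ t) ∂M.trajLaw π := by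
  have h := hasSum_sum (s := Finset.univ) fun x _ =>
    (M.hasSum_discounted_meanAt π (Set.indicator {x} 1)).mul_right (g x)
  have h' := M.hasSum_discounted_meanAt π g
  have e : (fun t => M.γ ^ t * M.meanAt π t g) = fun t =>
      ∑ x, M.γ ^ t * M.meanAt π t (Set.indicator {x} 1) * g x := by
    ext t
    rw [meanAt_eq_sum, Finset.mul_sum]
    simp only [mul_assoc]
  rw [e] at h'
  rw [h'.unique h, Finset.mul_sum]
  simp only [occ, mul_assoc]

lemma J_eq_sum_occ : M.J π = (∑ x, M.occ π x * M.R x) / (1 - M.γ) := by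
  have : 1 - M.γ ≠ 0 := (sub_pos.2 M.γ_lt_one).ne'
  rw [sum_occ_mul, J]
  field_simp

/-- The flow equation of the discounted occupancy. -/
lemma sum_occ_mul_sub_transOp (g : S × A → ℝ) :
    ∑ x, M.occ π x * (g x - M.γ * M.transOp π g x) = (1 - M.γ) * π.avg g M.s₀ := by
  have h := M.hasSum_discounted_meanAt π g
  have h' := (M.hasSum_discounted_meanAt π (M.transOp π g)).mul_left M.γ
  have e : (fun t => M.γ * (M.γ ^ t * M.meanAt π t (M.transOp π g))) =
      fun t => M.γ ^ (t + 1) * M.meanAt π (t + 1) g := by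
    ext t
    rw [meanAt_succ, pow_succ]
    ring
  rw [e] at h'
  -- Applying `P^π` shifts time by one, so the two series differ only in the term at time `0`.
  have h0 := ((hasSum_nat_add_iff' 1).2 h).unique h'
  simp only [Finset.range_one, Finset.sum_singleton, pow_zero, one_mul, meanAt_zero] at h0
  have : ∀ x, M.occ π x * (g x - M.γ * M.transOp π g x) =
      M.occ π x * g x - M.γ * (M.occ π x * M.transOp π g x) := fun x => by ring
  simp only [this, Finset.sum_sub_distrib, ← Finset.mul_sum, sum_occ_mul]
  linear_combination (1 - M.γ) * h0

/-- Evaluation error as the mean Bellman error under the occupancy. -/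
lemma avg_sub_J (f : S × A → ℝ) :
    π.avg f M.s₀ - M.J π = (∑ x, M.occ π x * (f - M.bellman π f) x) / (1 - M.γ) := by
  have hγ : 1 - M.γ ≠ 0 := (sub_pos.2 M.γ_lt_one).ne'
  have h := M.sum_occ_mul_sub_transOp π f
  have : ∀ x, M.occ π x * (f - M.bellman π f) x =
      M.occ π x * (f x - M.γ * M.transOp π f x) - M.occ π x * M.R x := fun x => by
    simp only [Pi.sub_apply, bellman]
    ring
  simp only [this, Finset.sum_sub_distrib, h, J_eq_sum_occ]
  field_simp

lemma occ_nonneg (x : S × A) : 0 ≤ M.occ π x := by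
  refine mul_nonneg (sub_nonneg.2 M.γ_lt_one.le) (integral_nonneg fun τ => tsum_nonneg fun t =>
    mul_nonneg (pow_nonneg M.γ_nonneg t) (Set.indicator_nonneg (by simp) _))

lemma occ_mem_stdSimplex : M.occ π ∈ stdSimplex ℝ (S × A) := by
  refine ⟨M.occ_nonneg π, ?_⟩
  have hγ : 1 - M.γ ≠ 0 := (sub_pos.2 M.γ_lt_one).ne'
  have h := M.sum_occ_mul π fun _ => 1
  simp only [mul_one, tsum_geometric_of_lt_one M.γ_nonneg M.γ_lt_one] at h
  rw [h]
  simp [hγ]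

end Trajectory

end MDP

/-! ### Exponential moments of loss differences. -/

lemma sqNorm_nonneg {X : Type*} [Fintype X] {w : X → ℝ} (hw : ∀ x, 0 ≤ w x) (f : X → ℝ) :
    0 ≤ sqNorm w f :=
  Finset.sum_nonneg fun x _ => mul_nonneg (hw x) (sq_nonneg _)

lemma Real.exp_le_one_add_add_sq {x : ℝ} (hx : |x| ≤ 1) : Real.exp x ≤ 1 + x + x ^ 2 := by
  linarith [le_abs_self (Real.exp x - 1 - x), Real.abs_exp_sub_one_sub_id_le hx]

/-- Exponential moment of a difference of square losses of two predictions `a`, `b` of a bounded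
random variable `y`. -/
lemma sum_weight_exp_sq_sub_sq_le {α : Type*} [Fintype α] (p : PMF α) {V a b m : ℝ} {y : α → ℝ}
    (hV : 0 < V) (ha : a ∈ Set.Icc 0 V) (hb : b ∈ Set.Icc 0 V) (hy : ∀ s, y s ∈ Set.Icc 0 V)
    (hm : ∑ s, p.weight s * y s = m) :
    ∑ s, p.weight s * Real.exp (1 / (16 * V ^ 2) * ((a - y s) ^ 2 - (b - y s) ^ 2)) ≤
      1 + 1 / (16 * V ^ 2) * (3 / 2 * (a - m) ^ 2 - 1 / 2 * (b - m) ^ 2) := by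
  set l := 1 / (16 * V ^ 2) with hl
  have hl0 : 0 < l := by positivity
  have hlV : l * V ^ 2 = 1 / 16 := by rw [hl]; field_simp
  have key : ∀ s, Real.exp (l * ((a - y s) ^ 2 - (b - y s) ^ 2)) ≤
      1 + l * (a ^ 2 - b ^ 2) - 2 * l * (a - b) * y s + l / 4 * (a - b) ^ 2 := fun s => by
    obtain ⟨ha0, ha1⟩ := ha
    obtain ⟨hb0, hb1⟩ := hb
    obtain ⟨hy0, hy1⟩ := hy s
    have h1 : (a - y s) ^ 2 ≤ V ^ 2 := sq_le_sq' (by linarith) (by linarith)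
    have h2 : (b - y s) ^ 2 ≤ V ^ 2 := sq_le_sq' (by linarith) (by linarith)
    have hX : |l * ((a - y s) ^ 2 - (b - y s) ^ 2)| ≤ 1 := by
      rw [abs_mul, abs_of_pos hl0]
      have : |(a - y s) ^ 2 - (b - y s) ^ 2| ≤ V ^ 2 := by
        rw [abs_le]
        constructor <;> nlinarith [sq_nonneg (a - y s), sq_nonneg (b - y s)]
      nlinarith
    have h3 : (a + b - 2 * y s) ^ 2 ≤ 4 * V ^ 2 := by
      rw [show 4 * V ^ 2 = (2 * V) ^ 2 by ring]
      exact sq_le_sq' (by linarith) (by linarith)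
    -- The loss difference factors as `(a - b)(a + b - 2y)`; its square is thus of order `(a - b)²`,
    -- which yields a `1/n` rate instead of `1/√n`.
    have h4 : (l * ((a - y s) ^ 2 - (b - y s) ^ 2)) ^ 2 ≤ l / 4 * (a - b) ^ 2 := by
      calc (l * ((a - y s) ^ 2 - (b - y s) ^ 2)) ^ 2
          = (l ^ 2 * (a - b) ^ 2) * (a + b - 2 * y s) ^ 2 := by ring
        _ ≤ (l ^ 2 * (a - b) ^ 2) * (4 * V ^ 2) := by gcongr
        _ = 4 * l * (a - b) ^ 2 * (l * V ^ 2) := by ring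
        _ = l / 4 * (a - b) ^ 2 := by rw [hlV]; ring
    have h5 := Real.exp_le_one_add_add_sq hX
    linarith [show l * ((a - y s) ^ 2 - (b - y s) ^ 2) =
      l * (a ^ 2 - b ^ 2) - 2 * l * (a - b) * y s by ring]
  calc _ ≤ ∑ s, p.weight s *
        (1 + l * (a ^ 2 - b ^ 2) - 2 * l * (a - b) * y s + l / 4 * (a - b) ^ 2) :=
        Finset.sum_le_sum fun s _ => mul_le_mul_of_nonneg_left (key s) (p.weight_nonneg s)
    _ = 1 + l * (a ^ 2 - b ^ 2) + l / 4 * (a - b) ^ 2 - 2 * l * (a - b) * m := by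
        have : ∀ s, p.weight s *
            (1 + l * (a ^ 2 - b ^ 2) - 2 * l * (a - b) * y s + l / 4 * (a - b) ^ 2) =
            p.weight s * (1 + l * (a ^ 2 - b ^ 2) + l / 4 * (a - b) ^ 2) -
              2 * l * (a - b) * (p.weight s * y s) := fun s => by ring
        simp only [this, Finset.sum_sub_distrib, ← Finset.mul_sum, hm, p.sum_weight_mul_const]
    -- The linear part equals `l((a - m)² - (b - m)²)`, and `(a - b)² ≤ 2(a - m)² + 2(b - m)²`; the
    -- defect in the latter is `(a + b - 2m)²`.
    _ ≤ _ := by nlinarith [mul_nonneg hl0.le (sq_nonneg (a + b - 2 * m))]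

namespace MDP

section Sample

variable {S A : Type*} (M : MDP S A)

lemma Rmax_add_γ_mul_Vmax : M.Rmax + M.γ * M.Vmax = M.Vmax := by
  have : 1 - M.γ ≠ 0 := (sub_pos.2 M.γ_lt_one).ne'
  unfold Vmax
  field_simp
  ring

/-- The data tuple determined by `(s, a)` and `s'`. -/
def toSample (z : (S × A) × S) : S × A × ℝ × S := (z.1.1, z.1.2, M.R z.1, z.2)

/-- A tuple has a real coordinate, but the reward is determined by `(s, a)`. Factoring the law
through the finite space of `((s, a), s')` reduces integrals to finite sums. -/
lemma samplePMF_eq_map (μ : PMF (S × A)) :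
    M.samplePMF μ = (μ.bind fun x => (M.P x).map (Prod.mk x)).map M.toSample := by
  simp only [samplePMF, PMF.map_bind, PMF.map_comp]
  rfl

/-- The square loss of `f'` at one data tuple, for the regression target given by `f`. -/
noncomputable def pointLoss [Fintype A] (π : Policy S A) (f' f : S × A → ℝ)
    (d : S × A × ℝ × S) : ℝ :=
  (f' (d.1, d.2.1) - d.2.2.1 - M.γ * π.avg f d.2.2.2) ^ 2

lemma loss_eq_sum_pointLoss [Fintype S] [Fintype A] {n : ℕ} (D : Fin n → S × A × ℝ × S)
    (π : Policy S A)
    (f' f : S × A → ℝ) : M.loss D π f' f = (∑ i, M.pointLoss π f' f (D i)) / n := by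
  simp only [loss, pointLoss, div_eq_inv_mul, mul_one]

end Sample

variable {S A : Type*} [Fintype S] [Fintype A] (M : MDP S A)

variable [MeasurableSpace S] [MeasurableSingletonClass S] [MeasurableSpace A]
  [MeasurableSingletonClass A]

lemma measurable_pointLoss (π : Policy S A) (f' f : S × A → ℝ) :
    Measurable (M.pointLoss π f' f) := by
  have h1 : Measurable f' := .of_discrete
  have h2 : Measurable (π.avg f) := .of_discrete
  unfold pointLoss
  fun_prop

lemma samplePMF_toMeasure (μ : PMF (S × A)) : (M.samplePMF μ).toMeasure =
    (μ.bind fun x => (M.P x).map (Prod.mk x)).toMeasure.map M.toSample := by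
  rw [PMF.toMeasure_map (f := M.toSample) (hf := .of_discrete), samplePMF_eq_map]

lemma integrable_samplePMF (μ : PMF (S × A)) {G : S × A × ℝ × S → ℝ} (hG : Measurable G) :
    Integrable G (M.samplePMF μ).toMeasure := by
  rw [samplePMF_toMeasure, integrable_map_measure hG.aestronglyMeasurable
    (Measurable.of_discrete).aemeasurable]
  exact .of_finite

lemma integral_samplePMF (μ : PMF (S × A)) {G : S × A × ℝ × S → ℝ} (hG : Measurable G) :
    ∫ d, G d ∂(M.samplePMF μ).toMeasure =
      ∑ x, μ.weight x * ∑ s', (M.P x).weight s' * G (x.1, x.2, M.R x, s') := by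
  rw [samplePMF_toMeasure, integral_map (Measurable.of_discrete).aemeasurable
    hG.aestronglyMeasurable, PMF.integral_eq_sum_weight]
  simp only [PMF.sum_weight_bind_mul, PMF.sum_weight_map_mul, toSample]

/-- Given `(s, a)`, the target `r + γ h(s', π)` lies in `[0, V_max]` and has mean `(T^π h)(s, a)`.
The scalar bound applies at each `(s, a)` and is then averaged over `μ`. -/
lemma integral_exp_pointLoss_sub_le (μ : PMF (S × A)) (π : Policy S A) {f g h : S × A → ℝ}
    (hV : 0 < M.Vmax) (hf : ∀ x, f x ∈ Set.Icc 0 M.Vmax) (hg : ∀ x, g x ∈ Set.Icc 0 M.Vmax)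
    (hh : ∀ x, h x ∈ Set.Icc 0 M.Vmax) :
    ∫ d, Real.exp (1 / (16 * M.Vmax ^ 2) * (M.pointLoss π f h d - M.pointLoss π g h d))
        ∂(M.samplePMF μ).toMeasure ≤
      Real.exp (1 / (16 * M.Vmax ^ 2) * (3 / 2 * sqNorm μ.weight (f - M.bellman π h) -
        1 / 2 * sqNorm μ.weight (g - M.bellman π h))) := by
  have hm1 := M.measurable_pointLoss π f h
  have hm2 := M.measurable_pointLoss π g h
  rw [M.integral_samplePMF μ (by fun_prop)]
  set l := 1 / (16 * M.Vmax ^ 2) with hl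
  have hx : ∀ x, ∑ s', (M.P x).weight s' * Real.exp (l *
      (M.pointLoss π f h (x.1, x.2, M.R x, s') - M.pointLoss π g h (x.1, x.2, M.R x, s'))) ≤
      1 + l * (3 / 2 * (f x - M.bellman π h x) ^ 2 - 1 / 2 * (g x - M.bellman π h x) ^ 2) :=
      fun x => by
    have := sum_weight_exp_sq_sub_sq_le (M.P x) (y := fun s' => M.R x + M.γ * π.avg h s')
      (m := M.bellman π h x) hV (hf x) (hg x) (fun s' => ?_) ?_
    · simpa only [pointLoss, sub_sub, hl] using this
    · obtain ⟨h0, h1⟩ := π.avg_mem_Icc hh s'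
      obtain ⟨r0, r1⟩ := M.R_mem x
      refine ⟨add_nonneg r0 (mul_nonneg M.γ_nonneg h0), ?_⟩
      linarith [M.Rmax_add_γ_mul_Vmax, mul_le_mul_of_nonneg_left h1 M.γ_nonneg]
    · simp only [mul_add, Finset.sum_add_distrib, PMF.sum_weight_mul_const, bellman, transOp,
        Finset.mul_sum, mul_left_comm]
  calc _ ≤ ∑ x, μ.weight x * (1 + l * (3 / 2 * (f x - M.bellman π h x) ^ 2 -
          1 / 2 * (g x - M.bellman π h x) ^ 2)) :=
        Finset.sum_le_sum fun x _ => mul_le_mul_of_nonneg_left (hx x) (μ.weight_nonneg x)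
    _ = l * (3 / 2 * sqNorm μ.weight (f - M.bellman π h) -
          1 / 2 * sqNorm μ.weight (g - M.bellman π h)) + 1 := by
        simp only [sqNorm, Finset.mul_sum, ← Finset.sum_sub_distrib, Pi.sub_apply, mul_add,
          mul_one, Finset.sum_add_distrib, μ.sum_weight]
        rw [add_comm]
        exact congrArg (· + 1) (Finset.sum_congr rfl fun x _ => by ring)
    _ ≤ _ := Real.add_one_le_exp _

/-! ### Uniform concentration of empirical losses. -/

variable {n : ℕ} {Ω : Type*} [MeasurableSpace Ω] {Pr : Measure Ω} [IsProbabilityMeasure Pr]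
  {D : Fin n → Ω → S × A × ℝ × S}

/-- One-sided concentration of a difference of empirical losses. -/
lemma measureReal_loss_sub_ge_le (μ : PMF (S × A)) (hn : 0 < n) (hD : ∀ i, Measurable (D i))
    (hindep : iIndepFun D Pr) (hlaw : ∀ i, Pr.map (D i) = (M.samplePMF μ).toMeasure)
    (π : Policy S A) {f g h : S × A → ℝ} (hV : 0 < M.Vmax)
    (hf : ∀ x, f x ∈ Set.Icc 0 M.Vmax) (hg : ∀ x, g x ∈ Set.Icc 0 M.Vmax)
    (hh : ∀ x, h x ∈ Set.Icc 0 M.Vmax) (t : ℝ) :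
    Pr.real {ω | 3 / 2 * sqNorm μ.weight (f - M.bellman π h) -
        1 / 2 * sqNorm μ.weight (g - M.bellman π h) + t ≤
        M.loss (fun i => D i ω) π f h - M.loss (fun i => D i ω) π g h} ≤
      Real.exp (-(n * t / (16 * M.Vmax ^ 2))) := by
  have hn' : (0 : ℝ) < n := Nat.cast_pos.2 hn
  set B := 3 / 2 * sqNorm μ.weight (f - M.bellman π h) -
    1 / 2 * sqNorm μ.weight (g - M.bellman π h) with hB
  set l := 1 / (16 * M.Vmax ^ 2) with hl
  have hl0 : 0 < l := by positivity
  let G : S × A × ℝ × S → ℝ := fun d => M.pointLoss π f h d - M.pointLoss π g h d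
  have hG : Measurable G := (M.measurable_pointLoss π f h).sub (M.measurable_pointLoss π g h)
  have hGi : ∀ i, Measurable fun ω => G (D i ω) := fun i => hG.comp (hD i)
  have hexp : Measurable fun d => Real.exp (l * G d) := by fun_prop
  have hind : iIndepFun (fun i ω => G (D i ω)) Pr := hindep.comp (fun _ => G) fun _ => hG
  have hint : ∀ i, Integrable (fun ω => Real.exp (l * G (D i ω))) Pr := fun i => by
    have := M.integrable_samplePMF μ hexp
    rw [← hlaw i] at this
    exact this.comp_measurable (hD i)
  have hmgf : ∀ i, mgf (fun ω => G (D i ω)) Pr l ≤ Real.exp (l * B) := fun i => by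
    have := M.integral_exp_pointLoss_sub_le μ π hV hf hg hh
    rwa [← hlaw i, integral_map (hD i).aemeasurable hexp.aestronglyMeasurable] at this
  have hset : {ω | B + t ≤ M.loss (fun i => D i ω) π f h - M.loss (fun i => D i ω) π g h} =
      {ω | n * (B + t) ≤ (∑ i, fun ω => G (D i ω)) ω} := by
    ext ω
    simp only [Set.mem_ofPred_eq, loss_eq_sum_pointLoss, ← sub_div, ← Finset.sum_sub_distrib,
      Finset.sum_apply, G]
    rw [le_div_iff₀ hn', mul_comm]
  rw [hset]
  -- Chernoff bound at the fixed parameter `l = 1/(16 V_max²)`; independence factors the moment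
  -- generating function.
  refine (measure_ge_le_exp_mul_mgf _ hl0.le
    (hind.integrable_exp_mul_sum hGi fun i _ => hint i)).trans ?_
  rw [hind.mgf_sum hGi]
  calc _ ≤ Real.exp (-l * (n * (B + t))) * ∏ _i : Fin n, Real.exp (l * B) := by
        gcongr with i
        · exact fun i _ => mgf_nonneg
        · exact hmgf i
    _ = Real.exp (-(n * t / (16 * M.Vmax ^ 2))) := by
        rw [Finset.prod_const, Finset.card_univ, Fintype.card_fin, ← Real.exp_nat_mul,
          ← Real.exp_add]
        congr 1
        rw [hl]
        ring

lemma measurable_loss (hD : ∀ i, Measurable (D i)) (π : Policy S A) (f' f : S × A → ℝ) :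
    Measurable fun ω => M.loss (fun i => D i ω) π f' f := by
  simp only [loss_eq_sum_pointLoss]
  exact (Finset.measurable_fun_sum _ fun i _ =>
    (M.measurable_pointLoss π f' f).comp (hD i)).div_const _

/-- Differences of empirical losses concentrate uniformly over the two classes. -/
lemma exists_uniform_loss_bound (μ : PMF (S × A)) {F : Finset (S × A → ℝ)}
    (hF : ∀ f ∈ F, ∀ x, f x ∈ Set.Icc 0 M.Vmax) (Pol : Finset (Policy S A)) (hn : 0 < n)
    {δ : ℝ} (hδ : δ ∈ Set.Ioo (0 : ℝ) 1) (hD : ∀ i, Measurable (D i))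
    (hindep : iIndepFun D Pr) (hlaw : ∀ i, Pr.map (D i) = (M.samplePMF μ).toMeasure) :
    ∃ G : Set Ω, MeasurableSet G ∧ ENNReal.ofReal (1 - δ) ≤ Pr G ∧
      ∀ ω ∈ G, ∀ π ∈ Pol, ∀ f ∈ F, ∀ g ∈ F, ∀ h ∈ F,
        M.loss (fun i => D i ω) π f h - M.loss (fun i => D i ω) π g h ≤
          3 / 2 * sqNorm μ.weight (f - M.bellman π h) -
            1 / 2 * sqNorm μ.weight (g - M.bellman π h) +
            48 * M.Vmax ^ 2 * Real.log ((F.card : ℝ) * Pol.card / δ) / n := by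
  obtain ⟨hδ0, hδ1⟩ := hδ
  have hn' : (0 : ℝ) < n := Nat.cast_pos.2 hn
  by_cases hV : 0 < M.Vmax
  swap
  -- If `V_max` is not positive, `F` has at most one element and every loss difference vanishes.
  · refine ⟨Set.univ, .univ, by simp [hδ0.le], fun ω _ π _ f hf g hg h _ => ?_⟩
    have hfg : f = g := funext fun x => by
      have h1 := hF f hf x
      have h2 := hF g hg x
      linarith [h1.1, h1.2, h2.1, h2.2]
    have hV0 : 0 ≤ M.Vmax := by
      obtain ⟨x, -⟩ := μ.support_nonempty
      exact (hF f hf x).1.trans (hF f hf x).2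
    have := sqNorm_nonneg μ.weight_nonneg (g - M.bellman π h)
    rw [hfg, le_antisymm (not_lt.1 hV) hV0]
    norm_num
    linarith
  set N : ℝ := (F.card : ℝ) * Pol.card with hN
  set t : ℝ := 48 * M.Vmax ^ 2 * Real.log (N / δ) / n with ht
  let bad : Policy S A × (S × A → ℝ) × (S × A → ℝ) × (S × A → ℝ) → Set Ω := fun q =>
    {ω | 3 / 2 * sqNorm μ.weight (q.2.1 - M.bellman q.1 q.2.2.2) -
        1 / 2 * sqNorm μ.weight (q.2.2.1 - M.bellman q.1 q.2.2.2) + t ≤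
        M.loss (fun i => D i ω) q.1 q.2.1 q.2.2.2 - M.loss (fun i => D i ω) q.1 q.2.2.1 q.2.2.2}
  let I := Pol ×ˢ F ×ˢ F ×ˢ F
  have hbad : ∀ q, MeasurableSet (bad q) := fun q =>
    measurableSet_le measurable_const
      ((M.measurable_loss hD _ _ _).sub (M.measurable_loss hD _ _ _))
  have hmeas : MeasurableSet (⋃ q ∈ I, bad q) := I.measurableSet_biUnion fun q _ => hbad q
  refine ⟨(⋃ q ∈ I, bad q)ᶜ, hmeas.compl, ?_, fun ω hω π hπ f hf g hg h hh => ?_⟩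
  · have hle : Pr.real (⋃ q ∈ I, bad q) ≤ δ := by
      rcases I.eq_empty_or_nonempty with hI | ⟨q, hq⟩
      · simp [hI, hδ0.le]
      have hF1 : (1 : ℝ) ≤ F.card := by
        simp only [I, Finset.mem_product] at hq
        exact_mod_cast Finset.card_pos.2 ⟨_, hq.2.1⟩
      have hP1 : (1 : ℝ) ≤ Pol.card := by
        simp only [I, Finset.mem_product] at hq
        exact_mod_cast Finset.card_pos.2 ⟨_, hq.1⟩
      have hN0 : 0 < N := by positivity
      -- `48 = 3 · 16`: the cube pays for the union over `|Π||F|³` quadruples `(π, f, g, h)`.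
      have hexp : Real.exp (-(n * t / (16 * M.Vmax ^ 2))) = (δ / N) ^ 3 := by
        have : -(n * t / (16 * M.Vmax ^ 2)) = (3 : ℕ) * Real.log (δ / N) := by
          rw [ht, ← inv_div N δ, Real.log_inv]
          push_cast
          field_simp
          ring
        rw [this, Real.exp_nat_mul, Real.exp_log (by positivity)]
      calc Pr.real (⋃ q ∈ I, bad q) ≤ ∑ q ∈ I, Pr.real (bad q) :=
            measureReal_biUnion_finset_le _ _
        _ ≤ ∑ _q ∈ I, (δ / N) ^ 3 := by
            refine Finset.sum_le_sum fun q hq => ?_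
            simp only [I, Finset.mem_product] at hq
            rw [← hexp]
            exact M.measureReal_loss_sub_ge_le μ hn hD hindep hlaw q.1 hV (hF _ hq.2.1)
              (hF _ hq.2.2.1) (hF _ hq.2.2.2) t
        _ = δ ^ 3 / Pol.card ^ 2 := by
            simp only [Finset.sum_const, nsmul_eq_mul, I, Finset.card_product, hN]
            push_cast
            field_simp
        _ ≤ δ ^ 3 := div_le_self (by positivity) (one_le_pow₀ hP1)
        _ ≤ δ := pow_le_of_le_one hδ0.le hδ1.le (by norm_num)
    rw [← ofReal_measureReal, probReal_compl_eq_one_sub hmeas]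
    exact ENNReal.ofReal_le_ofReal (by linarith)
  · by_contra hc
    refine hω (Set.mem_biUnion (x := (π, f, g, h)) ?_ (not_le.1 hc).le)
    simp [I, hπ, hf, hg, hh]

end MDP

/-! ### Attained infima, Cauchy–Schwarz and the logarithm. -/

/-- The infimum over an empty `F` is `∞`, so finiteness of `c` also rules out that case. -/
lemma exists_le_of_biInf_le {α : Type*} {F : Finset α} {Φ : α → ℝ≥0∞} {c : ℝ≥0∞} (hc : c ≠ ∞)
    (h : ⨅ f ∈ F, Φ f ≤ c) : ∃ f ∈ F, Φ f ≤ c := by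
  by_contra! hlt
  rw [← Finset.inf_eq_iInf] at h
  exact h.not_gt ((Finset.lt_inf_iff hc.lt_top).2 hlt)

lemma sum_mul_abs_le_sqrt_sqNorm {X : Type*} [Fintype X] {w : X → ℝ} (hw : w ∈ stdSimplex ℝ X)
    (f : X → ℝ) : ∑ x, w x * |f x| ≤ √(sqNorm w f) := by
  refine Real.le_sqrt_of_sq_le ?_
  have := Finset.sum_sq_le_sum_mul_sum_of_sq_le_mul Finset.univ (r := fun x => w x * |f x|)
    (f := w) (g := fun x => w x * f x ^ 2) (fun x _ => hw.1 x)
    (fun x _ => mul_nonneg (hw.1 x) (sq_nonneg _)) fun x _ =>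
      le_of_eq (by rw [mul_pow, sq_abs]; ring)
  rwa [hw.2, one_mul] at this

lemma log_card_mul_card_div_nonneg {α β : Type*} {s : Finset α} {t : Finset β} {δ : ℝ}
    (hδ : δ ∈ Set.Ioo (0 : ℝ) 1) {a : α} (ha : a ∈ s) {b : β} (hb : b ∈ t) :
    0 ≤ Real.log ((s.card : ℝ) * t.card / δ) := by
  have hs : (1 : ℝ) ≤ s.card := by exact_mod_cast Finset.card_pos.2 ⟨a, ha⟩
  have ht : (1 : ℝ) ≤ t.card := by exact_mod_cast Finset.card_pos.2 ⟨b, hb⟩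
  refine Real.log_nonneg ((one_le_div hδ.1).2 (hδ.2.le.trans ?_))
  exact one_le_mul_of_one_le_of_one_le hs ht

namespace MDP

/-! ### Version spaces and the shift coefficient. -/

section VersionSpace

variable {S A : Type*} [Fintype A] {M : MDP S A} {n : ℕ} {D : Fin n → S × A × ℝ × S}
  {F : Finset (S × A → ℝ)} {π : Policy S A} {f : S × A → ℝ} {ε : ℝ}

lemma finite_versionSpace (M : MDP S A) (D : Fin n → S × A × ℝ × S) (F : Finset (S × A → ℝ))
    (ε : ℝ) (π : Policy S A) : (M.versionSpace D F ε π).Finite :=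
  F.finite_toSet.subset fun _ h => h.1

lemma pessValue_le (hf : f ∈ M.versionSpace D F ε π) : M.pessValue D F ε π ≤ π.avg f M.s₀ := by
  have := (M.finite_versionSpace D F ε π).to_subtype
  exact ciInf_le (f := fun g : M.versionSpace D F ε π => π.avg g.1 M.s₀)
    (Set.finite_range _).bddBelow ⟨f, hf⟩

/-- Membership of `f` matters: a real infimum over an empty version space would be `0`. -/
lemma IsLowerFn.avg_le_pessValue (hf : M.IsLowerFn D F ε π f) :
    π.avg f M.s₀ ≤ M.pessValue D F ε π := by
  have : Nonempty (M.versionSpace D F ε π) := ⟨⟨f, hf.1⟩⟩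
  exact le_ciInf fun g => hf.2 g.2

end VersionSpace

section Learning

variable {S A : Type*} [Fintype S] [Fintype A] {M : MDP S A}

lemma Complete.exists_mem {μ : PMF (S × A)} {F : Finset (S × A → ℝ)} {Pol : Finset (Policy S A)}
    {εFF : ℝ} (h : M.Complete μ F Pol εFF) (hε : 0 ≤ εFF) {π : Policy S A} (hπ : π ∈ Pol)
    {f : S × A → ℝ} (hf : f ∈ F) : ∃ g ∈ F, sqNorm μ.weight (g - M.bellman π f) ≤ εFF := by
  obtain ⟨g, hg, hle⟩ := exists_le_of_biInf_le ENNReal.ofReal_ne_top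
    ((le_iSup₂ (f := fun f (_ : f ∈ F) => ⨅ f' ∈ F,
      ENNReal.ofReal (sqNorm μ.weight (f' - M.bellman π f))) f hf).trans (h π hπ))
  exact ⟨g, hg, (ENNReal.ofReal_le_ofReal_iff hε).1 hle⟩

/-- Clearing denominators agrees with the conventions for `0 / 0` and `x / 0`. The resulting
constraints are linear in `ν`, hence closed, which makes the minimum over `ν` attained. -/
lemma shiftCoeff_le_ofReal_iff {ν : S × A → ℝ} {μ : PMF (S × A)}
    {F : Finset (S × A → ℝ)} {π : Policy S A} {C : ℝ} (hC : 0 ≤ C) :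
    M.shiftCoeff ν μ F π ≤ ENNReal.ofReal C ↔ ∀ f ∈ F,
      sqNorm ν (f - M.bellman π f) ≤ C * sqNorm μ.weight (f - M.bellman π f) := by
  rw [shiftCoeff, iSup₂_le_iff]
  refine forall₂_congr fun f _ => ?_
  rw [ENNReal.div_le_iff_le_mul (.inr ENNReal.ofReal_ne_top) (.inl ENNReal.ofReal_ne_top),
    ← ENNReal.ofReal_mul hC,
    ENNReal.ofReal_le_ofReal_iff (mul_nonneg hC (sqNorm_nonneg μ.weight_nonneg _))]

lemma weight_mem_shiftCoeff_le (M : MDP S A) (μ : PMF (S × A)) (F : Finset (S × A → ℝ))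
    (π : Policy S A) {C : ℝ} (hC : 1 ≤ C) :
    μ.weight ∈ {ν | ν ∈ stdSimplex ℝ (S × A) ∧ M.shiftCoeff ν μ F π ≤ ENNReal.ofReal C} :=
  ⟨μ.weight_mem_stdSimplex, (shiftCoeff_le_ofReal_iff (zero_le_one.trans hC)).2 fun _ _ =>
    le_mul_of_one_le_left (sqNorm_nonneg μ.weight_nonneg _) hC⟩

lemma isCompact_shiftCoeff_le (M : MDP S A) (μ : PMF (S × A)) (F : Finset (S × A → ℝ))
    (π : Policy S A) {C : ℝ} (hC : 0 ≤ C) :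
    IsCompact {ν | ν ∈ stdSimplex ℝ (S × A) ∧ M.shiftCoeff ν μ F π ≤ ENNReal.ofReal C} := by
  simp only [shiftCoeff_le_ofReal_iff hC]
  refine (isCompact_stdSimplex ℝ (S × A)).inter_right
    (t := {ν | ∀ f ∈ F, sqNorm ν (f - M.bellman π f) ≤
      C * sqNorm μ.weight (f - M.bellman π f)}) ?_
  simp only [Set.ofPred_forall]
  refine isClosed_biInter fun f _ => isClosed_le ?_ continuous_const
  unfold sqNorm
  fun_prop

variable {n : ℕ} {D : Fin n → S × A × ℝ × S} {μ : PMF (S × A)} {F : Finset (S × A → ℝ)}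
  {π : Policy S A} {f : S × A → ℝ} {η ε : ℝ}

/-- No competitor `g` can beat `f` by more than `3/2 εF + η`, since the term `-1/2 ‖g - T^π f‖²`
only helps. -/
lemma mem_versionSpace_of_sqNorm_le (hf : f ∈ F) {εF : ℝ}
    (hle : sqNorm μ.weight (f - M.bellman π f) ≤ εF)
    (hloss : ∀ g ∈ F, M.loss D π f f - M.loss D π g f ≤
      3 / 2 * sqNorm μ.weight (f - M.bellman π f) -
        1 / 2 * sqNorm μ.weight (g - M.bellman π f) + η)
    (hε : 3 / 2 * εF + η ≤ ε) : f ∈ M.versionSpace D F ε π := by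
  refine ⟨hf, ?_⟩
  have : Nonempty F := ⟨⟨f, hf⟩⟩
  rw [empError, sub_le_comm]
  refine le_ciInf fun g => ?_
  linarith [hloss g g.2, sqNorm_nonneg μ.weight_nonneg (g.1 - M.bellman π f)]

/-- With `g` close to `T^π f`, the loss of `f` exceeds that of `g` by at least `1/2 ‖f - T^π f‖² -
3/2 εFF - η`, while membership caps this excess at `ε`. -/
lemma sqNorm_le_of_mem_versionSpace (hf : f ∈ M.versionSpace D F ε π) {g : S × A → ℝ}
    (hg : g ∈ F) {εFF : ℝ} (hle : sqNorm μ.weight (g - M.bellman π f) ≤ εFF)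
    (hloss : M.loss D π g f - M.loss D π f f ≤
      3 / 2 * sqNorm μ.weight (g - M.bellman π f) -
        1 / 2 * sqNorm μ.weight (f - M.bellman π f) + η) :
    sqNorm μ.weight (f - M.bellman π f) ≤ 2 * ε + 3 * εFF + 2 * η := by
  have h1 : M.loss D π f f - ⨅ f' : F, M.loss D π f' f ≤ ε := hf.2
  have h2 : ⨅ f' : F, M.loss D π f' f ≤ M.loss D π g f :=
    ciInf_le (Set.finite_range _).bddBelow (⟨g, hg⟩ : F)
  linarith

end Learning

/-! ### Value gaps and the regret bound. -/

section Regret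

variable {S A : Type*} [Fintype S] [Fintype A]
  [MeasurableSpace S] [MeasurableSingletonClass S]
  [MeasurableSpace A] [MeasurableSingletonClass A] {M : MDP S A}

lemma Realizable.exists_mem {μ : PMF (S × A)} {F : Finset (S × A → ℝ)}
    {Pol : Finset (Policy S A)} {εF : ℝ} (h : M.Realizable μ F Pol εF) (hε : 0 ≤ εF)
    {π : Policy S A} (hπ : π ∈ Pol) :
    ∃ f ∈ F, sqNorm (M.occ π) (f - M.bellman π f) ≤ εF ∧
      sqNorm μ.weight (f - M.bellman π f) ≤ εF := by
  obtain ⟨f, hf, hle⟩ := exists_le_of_biInf_le ENNReal.ofReal_ne_top (h π hπ)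
  have hν : ∀ ν ∈ M.occ '' (Pol : Set (Policy S A)) ∪ {μ.weight},
      sqNorm ν (f - M.bellman π f) ≤ εF := fun ν hν =>
    (ENNReal.ofReal_le_ofReal_iff hε).1 ((le_iSup₂ (f := fun ν
      (_ : ν ∈ M.occ '' (Pol : Set (Policy S A)) ∪ {μ.weight}) =>
        ENNReal.ofReal (sqNorm ν (f - M.bellman π f))) ν hν).trans hle)
  exact ⟨f, hf, hν _ (.inl ⟨π, hπ, rfl⟩), hν _ (.inr rfl)⟩

lemma abs_avg_sub_J_le (M : MDP S A) (π : Policy S A) (f : S × A → ℝ) :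
    |π.avg f M.s₀ - M.J π| ≤ √(sqNorm (M.occ π) (f - M.bellman π f)) / (1 - M.γ) := by
  have hγ : 0 < 1 - M.γ := sub_pos.2 M.γ_lt_one
  rw [avg_sub_J, abs_div, abs_of_pos hγ]
  gcongr
  refine (Finset.abs_sum_le_sum_abs _ _).trans
    (le_trans (le_of_eq ?_) (sum_mul_abs_le_sqrt_sqNorm (M.occ_mem_stdSimplex π) _))
  simp only [abs_mul, abs_of_nonneg (M.occ_nonneg π _)]

lemma exists_isLeast_offSupport (M : MDP S A) (μ : PMF (S × A)) (F : Finset (S × A → ℝ))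
    (π : Policy S A) (Δf : S × A → ℝ) {C : ℝ} (hC : 1 ≤ C) :
    ∃ e, IsLeast (M.offSupport π Δf ''
      {ν | ν ∈ stdSimplex ℝ (S × A) ∧ M.shiftCoeff ν μ F π ≤ ENNReal.ofReal C}) e := by
  refine ((M.isCompact_shiftCoeff_le μ F π (zero_le_one.trans hC)).image ?_).exists_isLeast
    (.image _ ⟨_, M.weight_mem_shiftCoeff_le μ F π hC⟩)
  unfold offSupport
  fun_prop

/-- The gap between two value estimates at the initial state, split along a distribution `ν` into
an off-support part and the Bellman errors under `ν`. -/
lemma avg_sub_avg_le_offSupport_add (M : MDP S A) (π : Policy S A) {ν : S × A → ℝ}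
    (hν : ν ∈ stdSimplex ℝ (S × A)) (f g : S × A → ℝ) :
    π.avg f M.s₀ - π.avg g M.s₀ ≤ M.offSupport π (f - g) ν +
      (√(sqNorm ν (f - M.bellman π f)) + √(sqNorm ν (g - M.bellman π g))) / (1 - M.γ) := by
  have hγ : 0 < 1 - M.γ := sub_pos.2 M.γ_lt_one
  have hflow := M.sum_occ_mul_sub_transOp π (f - g)
  rw [Policy.avg_sub] at hflow
  have hsplit : ∀ x, M.occ π x * ((f - g) x - M.γ * M.transOp π (f - g) x) ≤
      max (M.occ π x - ν x) 0 * ((f - g) x - M.γ * M.transOp π (f - g) x) +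
        (ν x * |(f - M.bellman π f) x| + ν x * |(g - M.bellman π g) x|) := fun x => by
    have hz : (f - g) x - M.γ * M.transOp π (f - g) x =
        (f - M.bellman π f) x - (g - M.bellman π g) x := by
      simp only [transOp_sub, Pi.sub_apply, bellman]
      ring
    have hmin : M.occ π x = max (M.occ π x - ν x) 0 + min (M.occ π x) (ν x) := by
      rcases le_total (M.occ π x) (ν x) with h | h
      · rw [max_eq_right (by linarith), min_eq_left h, zero_add]
      · rw [max_eq_left (by linarith), min_eq_right h, sub_add_cancel]
    rw [hz]
    set z := (f - M.bellman π f) x - (g - M.bellman π g) x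
    calc M.occ π x * z = max (M.occ π x - ν x) 0 * z + min (M.occ π x) (ν x) * z := by
          rw [← add_mul, ← hmin]
      _ ≤ _ := by
          rw [← mul_add]
          refine add_le_add_right ?_ _
          calc min (M.occ π x) (ν x) * z ≤ min (M.occ π x) (ν x) * |z| :=
                mul_le_mul_of_nonneg_left (le_abs_self z) (le_min (M.occ_nonneg π x) (hν.1 x))
            _ ≤ ν x * |z| := mul_le_mul_of_nonneg_right (min_le_right _ _) (abs_nonneg z)
            _ ≤ _ := mul_le_mul_of_nonneg_left (abs_sub _ _) (hν.1 x)
  have hsum := Finset.sum_le_sum fun x (_ : x ∈ Finset.univ) => hsplit x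
  rw [hflow, Finset.sum_add_distrib, Finset.sum_add_distrib] at hsum
  rw [offSupport, one_div_mul_eq_div, ← add_div, le_div_iff₀ hγ, mul_comm]
  linarith [sum_mul_abs_le_sqrt_sqNorm hν (f - M.bellman π f),
    sum_mul_abs_le_sqrt_sqNorm hν (g - M.bellman π g)]

end Regret

end MDP

theorem theorem1 :
    ∃ c : ℝ, 0 < c ∧
      ∀ {S : Type u} {A : Type v} [Fintype S] [MeasurableSpace S] [MeasurableSingletonClass S]
        [Fintype A] [MeasurableSpace A] [MeasurableSingletonClass A]
        (M : MDP S A) (μ : PMF (S × A))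
        (F : Finset (S × A → ℝ)) (_hF : ∀ f ∈ F, ∀ x, f x ∈ Set.Icc 0 M.Vmax)
        (Pol : Finset (Policy S A))
        (εF εFF : ℝ) (_hεF : 0 ≤ εF) (_hεFF : 0 ≤ εFF)
        (_hreal : M.Realizable μ F Pol εF) (_hcomp : M.Complete μ F Pol εFF)
        (n : ℕ) (_hn : 0 < n) (δ : ℝ) (_hδ : δ ∈ Set.Ioo (0 : ℝ) 1)
        {Ω : Type w} [MeasurableSpace Ω] (Pr : Measure Ω) [IsProbabilityMeasure Pr]
        (D : Fin n → Ω → S × A × ℝ × S) (_hD : ∀ i, Measurable (D i))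
        (_hindep : iIndepFun D Pr) (_hlaw : ∀ i, Pr.map (D i) = (M.samplePMF μ).toMeasure)
        (ε : ℝ) (_hε : ε = M.threshold F Pol n δ εF),
        ∃ G : Set Ω, MeasurableSet G ∧ ENNReal.ofReal (1 - δ) ≤ Pr G ∧
          ∀ ω ∈ G,
            (∀ π ∈ Pol, (M.versionSpace (fun i => D i ω) F ε π).Nonempty) ∧
            ∀ πhat, M.IsPessimisticPolicy (fun i => D i ω) F Pol ε πhat →
              ∀ π ∈ Pol, ∀ fmax fmin,
                M.IsUpperFn (fun i => D i ω) F ε π fmax →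
                M.IsLowerFn (fun i => D i ω) F ε π fmin →
                ∀ C₂ : ℝ, 1 ≤ C₂ →
                  ∃ errOff : ℝ,
                    IsLeast (M.offSupport π (fmax - fmin) ''
                      {ν | ν ∈ stdSimplex ℝ (S × A) ∧
                        M.shiftCoeff ν μ F π ≤ ENNReal.ofReal C₂}) errOff ∧
                    M.J π - M.J πhat ≤ c * M.onSupportRate F Pol n δ εF εFF C₂ + errOff := by
  refine ⟨40, by norm_num, ?_⟩
  intro S A _ _ _ _ _ _ M μ F hF Pol εF εFF hεF hεFF hreal hcomp n hn δ hδ Ω _ Pr _ D hD hindep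
    hlaw ε hε
  obtain ⟨G, hGm, hGp, hG⟩ := M.exists_uniform_loss_bound μ hF Pol hn hδ hD hindep hlaw
  refine ⟨G, hGm, hGp, fun ω hω => ?_⟩
  replace hG := hG ω hω
  set L := Real.log ((F.card : ℝ) * Pol.card / δ) with hL
  set q := √(L / n) with hq
  set Dω := fun i => D i ω
  have hε' : ε = 139 * (M.Vmax ^ 2 * (L / n)) + 39 * εF := by
    rw [hε, MDP.threshold, ← hL]
    ring
  have hη : 48 * M.Vmax ^ 2 * L / n = 48 * (M.Vmax ^ 2 * (L / n)) := by ring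
  rw [hη] at hG
  have hbest : ∀ π ∈ Pol, ∃ f ∈ M.versionSpace Dω F ε π,
      sqNorm (M.occ π) (f - M.bellman π f) ≤ εF := fun π hπ => by
    obtain ⟨f, hf, hocc, hμ⟩ := hreal.exists_mem hεF hπ
    have hL0 : 0 ≤ L := log_card_mul_card_div_nonneg hδ hf hπ
    have : 0 ≤ M.Vmax ^ 2 * (L / n) := by positivity
    exact ⟨f, MDP.mem_versionSpace_of_sqNorm_le hf hμ
      (fun g hg => hG π hπ f hf g hg f hf) (by rw [hε']; linarith), hocc⟩
  refine ⟨fun π hπ => (hbest π hπ).imp fun f hf => hf.1, ?_⟩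
  intro πhat hhat π hπ fmax fmin hmax hmin C₂ hC₂
  obtain ⟨e, he⟩ := M.exists_isLeast_offSupport μ F π (fmax - fmin) hC₂
  refine ⟨e, he, ?_⟩
  obtain ⟨⟨ν, ⟨hν, hshift⟩, rfl⟩, -⟩ := he
  have hγ : 0 < 1 - M.γ := sub_pos.2 M.γ_lt_one
  have hC0 : 0 ≤ C₂ := zero_le_one.trans hC₂
  have hL0 : 0 ≤ L := log_card_mul_card_div_nonneg hδ hmax.1.1 hπ
  have hV0 : 0 ≤ M.Vmax := by
    obtain ⟨x, -⟩ := μ.support_nonempty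
    exact (hF _ hmax.1.1 x).1.trans (hF _ hmax.1.1 x).2
  have hq2 : q ^ 2 = L / n := Real.sq_sqrt (by positivity)
  set p := √C₂ with hp
  have hp2 : p ^ 2 = C₂ := Real.sq_sqrt hC0
  set r := √(C₂ * (εFF + εF)) with hr
  have hr2 : r ^ 2 = C₂ * (εFF + εF) := Real.sq_sqrt (by positivity)
  -- `2ε + 3εFF + 2η` equals `374 V_max² L/n + 78 εF + 3 εFF`, covered by `20² = 400` and `9² = 81`.
  have hon : ∀ f ∈ M.versionSpace Dω F ε π,
      √(sqNorm ν (f - M.bellman π f)) ≤ 20 * (M.Vmax * p * q) + 9 * r := fun f hf => by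
    obtain ⟨g, hg, hgle⟩ := hcomp.exists_mem hεFF hπ hf.1
    have h1 := MDP.sqNorm_le_of_mem_versionSpace hf hg hgle (hG π hπ g hg f hf.1 f hf.1)
    have h2 := (MDP.shiftCoeff_le_ofReal_iff hC0).1 hshift f hf.1
    refine Real.sqrt_le_iff.2 ⟨by positivity,
      h2.trans ((mul_le_mul_of_nonneg_left h1 hC0).trans ?_)⟩
    have h3 : 0 ≤ C₂ * (M.Vmax ^ 2 * (L / n)) := by positivity
    have h4 : 0 ≤ M.Vmax * p * q * r := by positivity
    have h5 : (20 * (M.Vmax * p * q) + 9 * r) ^ 2 = 400 * (p ^ 2 * (M.Vmax ^ 2 * q ^ 2)) +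
        360 * (M.Vmax * p * q * r) + 81 * r ^ 2 := by ring
    rw [h5, hp2, hq2, hr2, hε']
    linarith [mul_nonneg hC0 hεF, mul_nonneg hC0 hεFF]
  -- `C₂ ≥ 1` absorbs the realizability error into the term with `C₂`.
  have hεr : √εF ≤ r := Real.sqrt_le_sqrt
    (by linarith [mul_nonneg (sub_nonneg.2 hC₂) hεF, mul_nonneg hC0 hεFF])
  have hJ : ∀ π f, sqNorm (M.occ π) (f - M.bellman π f) ≤ εF →
      |π.avg f M.s₀ - M.J π| ≤ r / (1 - M.γ) := fun π f h =>
    (M.abs_avg_sub_J_le π f).trans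
      (div_le_div_of_nonneg_right ((Real.sqrt_le_sqrt h).trans hεr) hγ.le)
  obtain ⟨f₁, hf₁, hocc₁⟩ := hbest π hπ
  obtain ⟨f₂, hf₂, hocc₂⟩ := hbest πhat hhat.1
  have hupper : π.avg f₁ M.s₀ ≤ π.avg fmax M.s₀ := hmax.2 hf₁
  have hpess : M.pessValue Dω F ε π ≤ M.pessValue Dω F ε πhat := hhat.2 hπ
  have hgap := M.avg_sub_avg_le_offSupport_add π hν fmax fmin
  have hon' := div_le_div_of_nonneg_right
    (add_le_add (hon fmax hmax.1) (hon fmin hmin.1)) hγ.le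
  -- `fmax` and `fmin` contribute `2 · 20` and `2 · 9`. Of the remaining `22`, the two value
  -- estimates need only `2`; the rest is slack giving both terms the constant `40`.
  have hrate : 40 * M.onSupportRate F Pol n δ εF εFF C₂ =
      (20 * (M.Vmax * p * q) + 9 * r + (20 * (M.Vmax * p * q) + 9 * r)) / (1 - M.γ) +
        22 * (r / (1 - M.γ)) := by
    rw [MDP.onSupportRate, ← hL, ← hq, ← hp, ← hr]
    ring
  have hr0 : 0 ≤ r / (1 - M.γ) := by positivity
  linarith [(abs_le.1 (hJ π f₁ hocc₁)).1, (abs_le.1 (hJ πhat f₂ hocc₂)).2,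
    MDP.pessValue_le hf₂, hmin.avg_le_pessValue]
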